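/- Let $n\ge 1$, let $0<r_1<r_2<\infty$ and $A=A(r_1,r_2)=\{x\in\mathbb R^n: r_1<|x|<r_2\}$, and let $p\colon A\to(1,\infty)$ be radial, $p(x)=p(|x|)$. Suppose that $1<p^-:=\operatorname{ess\,inf}_A p\le p^+:=\operatorname{ess\,sup}_A p<\infty$ and that $p$ is log-Hölder continuous with constant $C_{\log}>0$, that is, $|p(x)-p(y)|\le C_{\log}/\log(e+1/|x-y|)$ for all distinct $x,y\in A$. Put $E=\overline B(0,r_1)$, $F=\mathbb R^n\setminus B(0,r_2)$, and $$\operatorname{Cap}_{p(\cdot)}(E,F;A)=\inf_u\int_A|\nabla u(x)|^{p(x)}\,dx,$$ where the infimum is over all $u\in C_c^\infty(\mathbb R^n)$ with $u\ge 1$ on $E$ and $u\le 0$ on $F$. Let $\Gamma$ be the family of locally rectifiable curves that join the spheres $\{|x|=r_1\}$ and $\{|x|=r_2\}$ inside $A$ (all points of the curve other than its endpoints lie in $A$, and every compact subcurve without the endpoints has finite length), and let $$\mathrm M_{p(\cdot)}(\Gamma)=\inf_\rho\int_A\rho(x)^{p(x)}\,dx,$$ where the infimum is over all Borel functions $\rho\colon\mathbb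 R^n\to[0,\infty]$ with $\int_\gamma\rho\,ds\ge 1$ for all $\gamma\in\Gamma$. Let $\omega_{n-1}$ be the surface measure of the unit sphere of $\mathbb R^n$. Then there is a constant $C>0$ depending only on $n,p^-,p^+,C_{\log}$ such that $$\operatorname{Cap}_{p(\cdot)}(E,F;A)\ \ge\ \frac1C\,\mathrm M_{p(\cdot)}(\Gamma).$$ Moreover, there is exactly one $\lambda>0$ for which the function $$\rho_*(r)=\left(\frac{\lambda}{p(r)\,\omega_{n-1}\,r^{n-1}}\right)^{1/(p(r)-1)}$$ is integrable on $(r_1,r_2)$ with $\int_{r_1}^{r_2}\rho_*(r)\,dr=1$, and with this $\lambda$ $$\mathrm M_{p(\cdot)}(\Gamma)=\omega_{n-1}\int_{r_1}^{r_2}\rho_*(r)^{p(r)}\,r^{n-1}\,dr<\infty .$$ -/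

import Mathlib

open MeasureTheory Set
open scoped ENNReal ContDiff

namespace VarExp

/-- Euclidean space `ℝⁿ`. -/
abbrev Rn (n : ℕ) : Type := EuclideanSpace ℝ (Fin n)

/-- The open annulus `A(r₁, r₂) = {x : r₁ < |x| < r₂}`. -/
def annulus (n : ℕ) (r₁ r₂ : ℝ) : Set (Rn n) := {x | r₁ < ‖x‖ ∧ ‖x‖ < r₂}

/-- `ω_{n-1}`, the surface measure of the unit sphere of `ℝⁿ`. -/
noncomputable def sphereArea (n : ℕ) : ℝ :=
  ((volume : Measure (Rn n)).toSphere univ).toReal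

/-! ### Exponents -/

/-- `p` is log-Hölder continuous on `Ω` with constant `K > 0`. (At `x = y` the Lean quotient
`1 / 0 = 0` makes the inequality read `0 ≤ K`, which holds.) -/
def LogHolderOn {n : ℕ} (K : ℝ) (p : Rn n → ℝ) (Ω : Set (Rn n)) : Prop :=
  0 < K ∧ ∀ x ∈ Ω, ∀ y ∈ Ω, |p x - p y| ≤ K / Real.log (Real.exp 1 + 1 / dist x y)

/-- `p⁻`, the essential infimum of `p` over `Ω`, as an extended real. -/
noncomputable def pMinus {n : ℕ} (p : Rn n → ℝ) (Ω : Set (Rn n)) : EReal :=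
  essInf (fun x => (p x : EReal)) (volume.restrict Ω)

/-- `p⁺`, the essential supremum of `p` over `Ω`, as an extended real. -/
noncomputable def pPlus {n : ℕ} (p : Rn n → ℝ) (Ω : Set (Rn n)) : EReal :=
  essSup (fun x => (p x : EReal)) (volume.restrict Ω)

/-! ### Curves, line integrals, modulus -/

/-- A curve in `ℝⁿ`: a continuous map on a compact interval `[a, b]`, `a < b`
(the values of `toFun` outside `[a, b]` are irrelevant). -/
structure Curve (n : ℕ) where
  a : ℝ
  b : ℝ
  hab : a < b
  toFun : ℝ → Rn n
  cont : ContinuousOn toFun (Icc a b)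

/-- The curve is locally rectifiable: every compact subcurve over `[c, d] ⊆ (a, b)` has finite
length. (Rectifiable curves are a special case: the total length may be infinite here.) -/
def Curve.LocallyRectifiable {n : ℕ} (γ : Curve n) : Prop :=
  LocallyBoundedVariationOn γ.toFun (Ioo γ.a γ.b)

/-- `∫ ρ ds` over the subcurve `f|[c, d]`, through its parametrization by arc length
`f_s : [0, ℓ] → ℝⁿ`, namely `∫_0^ℓ ρ (f_s t) dt` with `ℓ` the length of `f|[c, d]`. -/
noncomputable def arcIntegral {n : ℕ} (ρ : Rn n → ℝ≥0∞) (f : ℝ → Rn n) (c d : ℝ) : ℝ≥0∞ :=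
  ∫⁻ t in Icc 0 (eVariationOn f (Icc c d)).toReal, ρ (naturalParameterization f (Icc c d) c t)

/-- `∫_γ ρ ds` for a locally rectifiable curve: the supremum of the integrals over the
compact subcurves. -/
noncomputable def Curve.lineIntegral {n : ℕ} (γ : Curve n) (ρ : Rn n → ℝ≥0∞) : ℝ≥0∞ :=
  ⨆ (c : ℝ) (d : ℝ) (_ : γ.a < c) (_ : c ≤ d) (_ : d < γ.b), arcIntegral ρ γ.toFun c d

/-- The locally rectifiable curves that join `E` to `F` inside `Ω`: one endpoint is in `E`, the
other in `F`, and all interior points are in `Ω`. -/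
def joiningCurves {n : ℕ} (E F Ω : Set (Rn n)) : Set (Curve n) :=
  {γ | γ.LocallyRectifiable ∧ γ.toFun γ.a ∈ E ∧ γ.toFun γ.b ∈ F ∧
    ∀ t ∈ Ioo γ.a γ.b, γ.toFun t ∈ Ω}

/-- The admissible densities: Borel functions `ρ : ℝⁿ → [0, ∞]` with `∫_γ ρ ds ≥ 1` for each
locally rectifiable `γ ∈ Γ`. -/
def admissible {n : ℕ} (Γ : Set (Curve n)) : Set (Rn n → ℝ≥0∞) :=
  {ρ | Measurable ρ ∧ ∀ γ ∈ Γ, γ.LocallyRectifiable → 1 ≤ γ.lineIntegral ρ}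

/-- The `p(·)`-modulus of `Γ` with respect to `Ω` (equal to `∞` if no density is admissible). -/
noncomputable def modulus {n : ℕ} (p : Rn n → ℝ) (Ω : Set (Rn n)) (Γ : Set (Curve n)) : ℝ≥0∞ :=
  ⨅ ρ ∈ admissible Γ, ∫⁻ x in Ω, ρ x ^ p x

/-! ### Capacity -/

/-- The test functions for the condenser `(E, F; Ω)`: `u` is `C^∞` with compact support contained
in `Ω ∪ E ∪ F`, `u ≥ 1` on `E` and `u ≤ 0` on `F`. If `E, F ⊆ Ω` this is `u ∈ C_c^∞(Ω)`; if
`Ω ∪ E ∪ F` is the whole space it is `u ∈ C_c^∞(ℝⁿ)`. -/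
def capTest {n : ℕ} (E F Ω : Set (Rn n)) : Set (Rn n → ℝ) :=
  {u | ContDiff ℝ ∞ u ∧ HasCompactSupport u ∧ tsupport u ⊆ Ω ∪ E ∪ F ∧
    (∀ x ∈ E, 1 ≤ u x) ∧ ∀ x ∈ F, u x ≤ 0}

/-- The `p(·)`-capacity of the condenser `(E, F; Ω)`. -/
noncomputable def capacity {n : ℕ} (p : Rn n → ℝ) (E F Ω : Set (Rn n)) : ℝ≥0∞ :=
  ⨅ u ∈ capTest E F Ω, ∫⁻ x in Ω, ‖gradient u x‖ₑ ^ p x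

/-! ### The extremal density -/

/-- `ρ_*(r) = (λ / (p(r) ω_{n-1} r^{n-1}))^{1/(p(r)-1)}`, where `q` is the radial profile
`r ↦ p(r)` of the exponent and `lam` is the multiplier `λ`. -/
noncomputable def rhoStar (n : ℕ) (q : ℝ → ℝ) (lam r : ℝ) : ℝ :=
  (lam / (q r * sphereArea n * r ^ (n - 1))) ^ (1 / (q r - 1))

/-- `lam > 0` satisfies the normalization condition `∫_{r₁}^{r₂} ρ_*(r) dr = 1`. -/
def IsMultiplier (n : ℕ) (q : ℝ → ℝ) (r₁ r₂ lam : ℝ) : Prop :=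
  0 < lam ∧ IntegrableOn (rhoStar n q lam) (Ioo r₁ r₂) ∧
    ∫ r in Ioo r₁ r₂, rhoStar n q lam r = 1

end VarExp

/-!
The problem reduces to one dimension. In polar coordinates `∫_A G ^ p` is the integral over unit
vectors `θ` of `∫ G(rθ) ^ q(r) r ^ (n-1) dr`, and every density `G` in sight has integral at least
`1` over each radial segment: an admissible density because radial segments belong to the curve
family, and `|∇u|` for a test function `u` because `u` drops from at least `1` to at most `0` along
the segment. Among functions `f` with `∫ f ≥ 1` on `(r₁, r₂)` the energy `∫ f ^ q r ^ (n-1)` is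
minimized by `ρ_*`: by convexity `f ^ q + (q - 1) ρ_* ^ q ≥ q ρ_* ^ (q - 1) f`, and `ρ_*` is chosen
so that `q ρ_* ^ (q - 1) r ^ (n-1) = λ / ω` does not depend on `r`
(`IsRadialExponent.energy_rhoStar_le`). Hence `ω ∫ ρ_* ^ q r ^ (n-1)` bounds both the modulus and
the capacity from below (`IsRadialExponent.le_lintegral_rpow`).

Conversely `x ↦ ρ_*(|x|)` is admissible: the norm of an arc length parametrization is `1`-Lipschitz
and takes every value in `(r₁, r₂)`, and `1`-Lipschitz maps do not increase Lebesgue measure, so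
that the line integral is at least `∫ ρ_* = 1` (`lintegral_Ioo_le_lineIntegral`). So the modulus
equals `ω ∫ ρ_* ^ q r ^ (n-1)`, and the capacity estimate holds with `C = 1`.

The multiplier exists by the intermediate value theorem, since `∫ ρ_*` depends continuously on `λ`,
and it is unique since raising `λ` by a factor `t > 1` raises `ρ_*` by at least the factor
`t ^ (1 / (p⁺ - 1))`. The log-Hölder condition enters only as continuity, which turns the essential
bounds on the exponent into pointwise ones.
-/

namespace VarExp

open Filter Topology

/-! ### Arc length parametrizations -/

theorem continuousOn_variationOnFromTo {E : Type*} [PseudoMetricSpace E] {f : ℝ → E} {s : Set ℝ}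
    (hf : ContinuousOn f s) (hbv : LocallyBoundedVariationOn f s) {a : ℝ} (ha : a ∈ s) :
    ContinuousOn (variationOnFromTo f s a) s := by
  intro x hx
  have hs : s ⊆ (s ∩ Iio x) ∪ insert x (s ∩ Ioi x) := by
    intro y hy
    rcases lt_trichotomy y x with h | h | h
    · exact Or.inl ⟨hy, h⟩
    · exact Or.inr (Or.inl h)
    · exact Or.inr (Or.inr ⟨hy, h⟩)
  refine ContinuousWithinAt.mono ?_ hs
  rw [continuousWithinAt_union, continuousWithinAt_insert_self]
  constructor
  · have := variationOnFromTo.tendsto_left (b := x) ha hx hbv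
      ((hf x hx).mono_left (nhdsWithin_mono _ inter_subset_left))
    simpa [ContinuousWithinAt] using this
  · have := variationOnFromTo.tendsto_right (b := x) ha hx hbv
      ((hf x hx).mono_left (nhdsWithin_mono _ inter_subset_left))
    simpa [ContinuousWithinAt] using this

theorem image_variationOnFromTo_Icc {E : Type*} [PseudoMetricSpace E] {f : ℝ → E} {c d : ℝ}
    (hcd : c ≤ d) (hf : ContinuousOn f (Icc c d)) (hbv : LocallyBoundedVariationOn f (Icc c d)) :
    variationOnFromTo f (Icc c d) c '' Icc c d =
      Icc 0 (eVariationOn f (Icc c d)).toReal := by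
  have hc : c ∈ Icc c d := left_mem_Icc.2 hcd
  have hd : d ∈ Icc c d := right_mem_Icc.2 hcd
  have h0 : variationOnFromTo f (Icc c d) c c = 0 := variationOnFromTo.self f _ c
  have h1 : variationOnFromTo f (Icc c d) c d = (eVariationOn f (Icc c d)).toReal := by
    rw [variationOnFromTo.eq_of_le _ _ hcd, inter_self]
  rw [← h1, ← h0]
  refine Subset.antisymm ?_
    (intermediate_value_Icc hcd (continuousOn_variationOnFromTo hf hbv hc))
  rintro _ ⟨t, ht, rfl⟩
  exact ⟨variationOnFromTo.monotoneOn hbv hc hc ht ht.1,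
    variationOnFromTo.monotoneOn hbv hc ht hd ht.2⟩

/-- Continuity of `f` is needed here: without it the parameters coming from points of `[c, d]` can
miss part of `[0, ℓ]`, where `naturalParameterization` takes arbitrary values. -/
theorem lipschitzOnWith_naturalParameterization {E : Type*} [PseudoMetricSpace E] {f : ℝ → E}
    {c d : ℝ} (hcd : c ≤ d) (hf : ContinuousOn f (Icc c d))
    (hbv : LocallyBoundedVariationOn f (Icc c d)) :
    LipschitzOnWith 1 (naturalParameterization f (Icc c d) c)
      (Icc 0 (eVariationOn f (Icc c d)).toReal) := by
  have hu := has_unit_speed_naturalParameterization f hbv (left_mem_Icc.2 hcd)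
  rw [image_variationOnFromTo_Icc hcd hf hbv] at hu
  intro x hx y hy
  wlog hxy : x ≤ y generalizing x y
  · rw [edist_comm, edist_comm x]
    exact this hy hx (le_of_not_ge hxy)
  have h := hu hx hy
  have := eVariationOn.edist_le (naturalParameterization f (Icc c d) c)
    (s := Icc 0 (eVariationOn f (Icc c d)).toReal ∩ Icc x y)
    ⟨hx, left_mem_Icc.2 hxy⟩ ⟨hy, right_mem_Icc.2 hxy⟩
  rw [h] at this
  rw [edist_comm x y, edist_dist y x, Real.dist_eq, abs_of_nonneg (sub_nonneg.2 hxy)]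
  simpa using this

/-- A `1`-Lipschitz function does not increase length, so that the line integral of a function of
the values dominates the integral over any set of attained values. -/
theorem setLIntegral_le_comp_of_lipschitzOnWith {h : ℝ → ℝ} {s B : Set ℝ} (hs : MeasurableSet s)
    (hh : LipschitzOnWith 1 h s) (hsB : B ⊆ h '' s) {φ : ℝ → ℝ≥0∞}
    (hφ : Measurable φ) : ∫⁻ r in B, φ r ≤ ∫⁻ t in s, φ (h t) := by
  have hm : AEMeasurable h (volume.restrict s) := hh.continuousOn.aemeasurable hs
  rw [← lintegral_map' hφ.aemeasurable hm]
  refine lintegral_mono' (Measure.le_iff.2 fun S hS => ?_) le_rfl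
  rw [Measure.map_apply_of_aemeasurable hm hS, Measure.restrict_apply hS,
    Measure.restrict_apply₀ (hm.nullMeasurable hS)]
  have hsub : S ∩ B ⊆ h '' (h ⁻¹' S ∩ s) := by
    rintro x ⟨hxS, hxB⟩
    obtain ⟨t, ht, rfl⟩ := hsB hxB
    exact ⟨t, ⟨hxS, ht⟩, rfl⟩
  refine (measure_mono hsub).trans ?_
  -- On `ℝ`, Lebesgue measure is the one-dimensional Hausdorff measure.
  have := (hh.mono (inter_subset_right (s := h ⁻¹' S))).hausdorffMeasure_image_le
    (zero_le_one (α := ℝ))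
  simpa [hausdorffMeasure_real] using this

/-! ### Line integrals of radial densities and along radial segments -/

theorem le_arcIntegral_of_norm {n : ℕ} {f : ℝ → Rn n} {c d : ℝ} (hcd : c ≤ d)
    (hf : ContinuousOn f (Icc c d)) (hbv : LocallyBoundedVariationOn f (Icc c d))
    {φ : ℝ → ℝ≥0∞} (hφ : Measurable φ) :
    ∫⁻ r in Icc ‖f c‖ ‖f d‖, φ r ≤ arcIntegral (fun x => φ ‖x‖) f c d := by
  refine setLIntegral_le_comp_of_lipschitzOnWith
    (h := fun t => ‖naturalParameterization f (Icc c d) c t‖) measurableSet_Icc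
    ?_ ?_ hφ
  · have := lipschitzWith_one_norm.comp_lipschitzOnWith
      (lipschitzOnWith_naturalParameterization hcd hf hbv)
    rwa [one_mul] at this
  · rintro r hr
    obtain ⟨t, ht, rfl⟩ := intermediate_value_Icc hcd hf.norm hr
    refine ⟨variationOnFromTo f (Icc c d) c t, ?_, ?_⟩
    · rw [← image_variationOnFromTo_Icc hcd hf hbv]
      exact mem_image_of_mem _ ht
    · have := edist_naturalParameterization_eq_zero hbv (left_mem_Icc.2 hcd) ht
      simp only [edist_eq_zero.1 this]

/-- A curve joining the boundary spheres crosses every intermediate radius, so the line integral of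
a radial density is at least its integral over `(r₁, r₂)`. -/
theorem lintegral_Ioo_le_lineIntegral {n : ℕ} {r₁ r₂ : ℝ} {γ : Curve n}
    (hγ : γ ∈ joiningCurves (Metric.sphere 0 r₁) (Metric.sphere 0 r₂) (annulus n r₁ r₂))
    {φ : ℝ → ℝ≥0∞} (hφ : Measurable φ) :
    ∫⁻ r in Ioo r₁ r₂, φ r ≤ γ.lineIntegral (fun x => φ ‖x‖) := by
  obtain ⟨hrect, ha, hb, -⟩ := hγ
  rw [mem_sphere_zero_iff_norm] at ha hb
  obtain ⟨m, hm⟩ := nonempty_Ioo.2 γ.hab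
  have hcont := γ.cont.norm
  have hsub : ∀ k : ℕ, ∫⁻ r in Icc (r₁ + 1 / (k + 1)) (r₂ - 1 / (k + 1)), φ r ≤
      γ.lineIntegral (fun x => φ ‖x‖) := by
    intro k
    have hk : (0 : ℝ) < 1 / (k + 1) := by positivity
    have hA : ∀ᶠ t in 𝓝[>] γ.a, ‖γ.toFun t‖ < r₁ + 1 / (k + 1) := by
      have h1 : Tendsto (fun t => ‖γ.toFun t‖) (𝓝[>] γ.a) (𝓝 ‖γ.toFun γ.a‖) := by
        have := (hcont γ.a (left_mem_Icc.2 γ.hab.le)).mono Ioo_subset_Icc_self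
        rwa [ContinuousWithinAt, nhdsWithin_Ioo_eq_nhdsGT γ.hab] at this
      exact h1.eventually_lt_const (by rw [ha]; linarith)
    have hB : ∀ᶠ t in 𝓝[<] γ.b, r₂ - 1 / (k + 1) < ‖γ.toFun t‖ := by
      have h1 : Tendsto (fun t => ‖γ.toFun t‖) (𝓝[<] γ.b) (𝓝 ‖γ.toFun γ.b‖) := by
        have := (hcont γ.b (right_mem_Icc.2 γ.hab.le)).mono Ioo_subset_Icc_self
        rwa [ContinuousWithinAt, nhdsWithin_Ioo_eq_nhdsLT γ.hab] at this
      exact h1.eventually_const_lt (by rw [hb]; linarith)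
    obtain ⟨c, hc, hc'⟩ := (hA.and (Ioo_mem_nhdsGT hm.1)).exists
    obtain ⟨d, hd, hd'⟩ := (hB.and (Ioo_mem_nhdsLT hm.2)).exists
    have hcd : c ≤ d := (hc'.2.trans hd'.1).le
    have hIoo : Icc c d ⊆ Ioo γ.a γ.b := Icc_subset_Ioo hc'.1 hd'.2
    calc ∫⁻ r in Icc (r₁ + 1 / (k + 1)) (r₂ - 1 / (k + 1)), φ r
        ≤ ∫⁻ r in Icc ‖γ.toFun c‖ ‖γ.toFun d‖, φ r :=
          lintegral_mono_set (Icc_subset_Icc hc.le hd.le)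
      _ ≤ arcIntegral (fun x => φ ‖x‖) γ.toFun c d :=
          le_arcIntegral_of_norm hcd (γ.cont.mono (hIoo.trans Ioo_subset_Icc_self))
            (BoundedVariationOn.mono
              (hrect c d (hIoo (left_mem_Icc.2 hcd)) (hIoo (right_mem_Icc.2 hcd)))
              (subset_inter hIoo Subset.rfl)).locallyBoundedVariationOn hφ
      _ ≤ γ.lineIntegral (fun x => φ ‖x‖) :=
          le_iSup_of_le c <| le_iSup_of_le d <| le_iSup_of_le hc'.1 <| le_iSup_of_le hcd <|
            le_iSup_of_le hd'.2 le_rfl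
  -- The subcurves omit the endpoints, so they only reach the radii strictly inside; exhaust
  -- `(r₁, r₂)` by compact intervals.
  have hun : Ioo r₁ r₂ ⊆ ⋃ k : ℕ, Icc (r₁ + 1 / ((k : ℝ) + 1)) (r₂ - 1 / ((k : ℝ) + 1)) := by
    intro x hx
    obtain ⟨k, hk⟩ := exists_nat_one_div_lt (lt_min (sub_pos.2 hx.1) (sub_pos.2 hx.2))
    rw [lt_min_iff] at hk
    exact mem_iUnion.2 ⟨k, by constructor <;> linarith⟩
  refine (lintegral_mono_set hun).trans ?_
  rw [setLIntegral_iUnion_of_directed]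
  · exact iSup_le hsub
  · refine Monotone.directed_le fun i j hij => ?_
    have : (1 : ℝ) / (j + 1) ≤ 1 / (i + 1) := Nat.one_div_le_one_div hij
    exact Icc_subset_Icc (by linarith) (by linarith)

theorem eVariationOn_smul_Icc {n : ℕ} {θ : Rn n} (hθ : ‖θ‖ = 1) (c d : ℝ) :
    eVariationOn (fun t : ℝ => t • θ) (Icc c d) = ENNReal.ofReal (d - c) := by
  have hiso : Isometry (fun t : ℝ => t • θ) := by
    refine Isometry.of_dist_eq fun x y => ?_
    rw [dist_eq_norm, ← sub_smul, norm_smul, hθ, mul_one, Real.dist_eq, Real.norm_eq_abs]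
  have h1 : eVariationOn (fun t : ℝ => t • θ) (Icc c d) = eVariationOn (id : ℝ → ℝ) (Icc c d) := by
    simp only [eVariationOn]
    simp only [hiso.edist_eq, id]
  rw [h1]
  rcases le_or_gt c d with h | h
  · have := (monotone_id.monotoneOn (Icc c d)).eVariationOn_eq (left_mem_Icc.2 h)
      (right_mem_Icc.2 h)
    rwa [inter_self] at this
  · rw [Icc_eq_empty h.not_ge, ENNReal.ofReal_of_nonpos (by linarith)]
    exact eVariationOn.subsingleton _ subsingleton_empty

theorem arcIntegral_smul {n : ℕ} {θ : Rn n} (hθ : ‖θ‖ = 1) {c d : ℝ} (hcd : c ≤ d)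
    (ρ : Rn n → ℝ≥0∞) :
    arcIntegral ρ (fun t : ℝ => t • θ) c d = ∫⁻ r in Icc c d, ρ (r • θ) := by
  have hbv : LocallyBoundedVariationOn (fun t : ℝ => t • θ) (Icc c d) := by
    refine BoundedVariationOn.locallyBoundedVariationOn ?_
    rw [BoundedVariationOn, eVariationOn_smul_Icc hθ]
    exact ENNReal.ofReal_ne_top
  have hnat : ∀ t ∈ Icc c d,
      naturalParameterization (fun t : ℝ => t • θ) (Icc c d) c (t - c) = t • θ := by
    intro t ht
    have h := edist_naturalParameterization_eq_zero hbv (left_mem_Icc.2 hcd) ht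
    rw [variationOnFromTo.eq_of_le _ _ ht.1, inter_eq_self_of_subset_right
      (Icc_subset_Icc le_rfl ht.2), eVariationOn_smul_Icc hθ,
      ENNReal.toReal_ofReal (sub_nonneg.2 ht.1)] at h
    exact edist_eq_zero.1 h
  rw [arcIntegral, eVariationOn_smul_Icc hθ, ENNReal.toReal_ofReal (sub_nonneg.2 hcd)]
  have hmp : MeasurePreserving (fun t : ℝ => t - c) volume volume :=
    measurePreserving_sub_right volume c
  have hemb : MeasurableEmbedding (fun t : ℝ => t - c) := measurableEmbedding_subRight c
  have hpre : (fun t : ℝ => t - c) ⁻¹' Icc 0 (d - c) = Icc c d := by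
    ext t; simp
  rw [← hmp.setLIntegral_comp_preimage_emb hemb, hpre]
  exact setLIntegral_congr_fun measurableSet_Icc fun t ht => by rw [hnat t ht]

/-- The radial segment from the sphere of radius `r₁` to the sphere of radius `r₂` in the
direction `θ`. -/
noncomputable def radialCurve {n : ℕ} (θ : Rn n) {r₁ r₂ : ℝ} (h : r₁ < r₂) : Curve n where
  a := r₁
  b := r₂
  hab := h
  toFun t := t • θ
  cont := by fun_prop

theorem radialCurve_mem_joiningCurves {n : ℕ} {θ : Rn n} (hθ : ‖θ‖ = 1) {r₁ r₂ : ℝ} (h₁ : 0 < r₁)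
    (h : r₁ < r₂) :
    radialCurve θ h ∈
      joiningCurves (Metric.sphere 0 r₁) (Metric.sphere 0 r₂) (annulus n r₁ r₂) := by
  have hnorm : ∀ t : ℝ, 0 < t → ‖t • θ‖ = t := fun t ht => by
    rw [norm_smul, hθ, mul_one, Real.norm_of_nonneg ht.le]
  refine ⟨?_, ?_, ?_, fun t ht => ?_⟩
  · intro x y _ _
    refine BoundedVariationOn.mono (s := Icc x y) ?_ inter_subset_right
    rw [BoundedVariationOn]
    exact (eVariationOn_smul_Icc hθ x y).trans_ne ENNReal.ofReal_ne_top
  · exact mem_sphere_zero_iff_norm.2 (hnorm _ h₁)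
  · exact mem_sphere_zero_iff_norm.2 (hnorm _ (h₁.trans h))
  · change r₁ < ‖t • θ‖ ∧ ‖t • θ‖ < r₂
    rw [hnorm t (h₁.trans ht.1)]
    exact ht

theorem lineIntegral_radialCurve_le {n : ℕ} {θ : Rn n} (hθ : ‖θ‖ = 1) {r₁ r₂ : ℝ} (h : r₁ < r₂)
    (ρ : Rn n → ℝ≥0∞) :
    (radialCurve θ h).lineIntegral ρ ≤ ∫⁻ r in Ioo r₁ r₂, ρ (r • θ) := by
  refine iSup_le fun c => iSup_le fun d => iSup_le fun hc => iSup_le fun hcd => iSup_le fun hd => ?_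
  exact (arcIntegral_smul hθ hcd ρ).trans_le (lintegral_mono_set (Icc_subset_Ioo hc hd))

/-! ### Polar coordinates in an annulus -/

/-- Integration in polar coordinates for nonnegative functions. -/
theorem lintegral_eq_lintegral_toSphere_lintegral {E : Type*} [NormedAddCommGroup E]
    [NormedSpace ℝ E] [FiniteDimensional ℝ E] [Nontrivial E] [MeasurableSpace E] [BorelSpace E]
    (μ : Measure E) [μ.IsAddHaarMeasure] {F : E → ℝ≥0∞} (hF : Measurable F) :
    ∫⁻ x, F x ∂μ = ∫⁻ θ : Metric.sphere (0 : E) 1, (∫⁻ r in Ioi (0 : ℝ),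
      ENNReal.ofReal (r ^ (Module.finrank ℝ E - 1)) * F (r • (θ : E))) ∂μ.toSphere := by
  have hmp := μ.measurePreserving_homeomorphUnitSphereProd
  have hm : Measurable fun z : Metric.sphere (0 : E) 1 × Ioi (0 : ℝ) =>
      F ((z.2 : ℝ) • (z.1 : E)) := by fun_prop
  calc ∫⁻ x, F x ∂μ = ∫⁻ x in ({0}ᶜ : Set E), F x ∂μ := by rw [restrict_compl_singleton]
    _ = ∫⁻ x : ({0}ᶜ : Set E), F x ∂(μ.comap Subtype.val) :=
        (lintegral_subtype_comap (measurableSet_singleton (0 : E)).compl F).symm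
    _ = ∫⁻ x : ({0}ᶜ : Set E), (fun z : Metric.sphere (0 : E) 1 × Ioi (0 : ℝ) =>
          F ((z.2 : ℝ) • (z.1 : E))) (homeomorphUnitSphereProd E x) ∂(μ.comap Subtype.val) := by
        refine lintegral_congr fun x => ?_
        congr 1
        simp [smul_smul, norm_ne_zero_iff.2 x.2]
    _ = ∫⁻ z, F ((z.2 : ℝ) • (z.1 : E))
          ∂(μ.toSphere.prod (Measure.volumeIoiPow (Module.finrank ℝ E - 1))) :=
        hmp.lintegral_comp hm
    _ = ∫⁻ θ, (∫⁻ r, F ((r : ℝ) • (θ : E)) ∂(Measure.volumeIoiPow (Module.finrank ℝ E - 1)))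
          ∂μ.toSphere := lintegral_prod _ hm.aemeasurable
    _ = _ := by
        refine lintegral_congr fun θ => ?_
        have hd : Measurable fun r : Ioi (0 : ℝ) =>
            ENNReal.ofReal (r.1 ^ (Module.finrank ℝ E - 1)) := by fun_prop
        rw [Measure.volumeIoiPow, lintegral_withDensity_eq_lintegral_mul _ hd (by fun_prop)]
        exact lintegral_subtype_comap measurableSet_Ioi
          (fun r : ℝ => ENNReal.ofReal (r ^ (Module.finrank ℝ E - 1)) * F (r • (θ : E)))

theorem isOpen_annulus (n : ℕ) (r₁ r₂ : ℝ) : IsOpen (annulus n r₁ r₂) :=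
  (isOpen_lt continuous_const continuous_norm).inter (isOpen_lt continuous_norm continuous_const)

theorem smul_mem_annulus_iff {n : ℕ} {r₁ r₂ r : ℝ} {θ : Rn n} (hθ : ‖θ‖ = 1) (hr : 0 ≤ r) :
    r • θ ∈ annulus n r₁ r₂ ↔ r ∈ Ioo r₁ r₂ := by
  rw [annulus, mem_ofPred_eq, norm_smul, hθ, mul_one, Real.norm_of_nonneg hr, mem_Ioo]

theorem lintegral_annulus {n : ℕ} (hn : 1 ≤ n) {r₁ r₂ : ℝ} (h₁ : 0 < r₁) {F : Rn n → ℝ≥0∞}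
    (hF : Measurable F) :
    ∫⁻ x in annulus n r₁ r₂, F x = ∫⁻ θ : Metric.sphere (0 : Rn n) 1, (∫⁻ r in Ioo r₁ r₂,
      ENNReal.ofReal (r ^ (n - 1)) * F (r • (θ : Rn n))) ∂(volume : Measure (Rn n)).toSphere := by
  have : NeZero n := ⟨by omega⟩
  have hA := (isOpen_annulus n r₁ r₂).measurableSet
  rw [← lintegral_indicator hA,
    lintegral_eq_lintegral_toSphere_lintegral volume (hF.indicator hA)]
  refine lintegral_congr fun θ => ?_
  have hθ : ‖(θ : Rn n)‖ = 1 := by simp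
  have hsub : Ioo r₁ r₂ ⊆ Ioi 0 := fun r hr => h₁.trans hr.1
  rw [← inter_eq_self_of_subset_left hsub, ← setLIntegral_indicator measurableSet_Ioo]
  refine setLIntegral_congr_fun measurableSet_Ioi fun r hr => ?_
  by_cases h : r ∈ Ioo r₁ r₂
  · rw [indicator_of_mem h, indicator_of_mem ((smul_mem_annulus_iff hθ (le_of_lt hr)).2 h),
      finrank_euclideanSpace_fin]
  · rw [indicator_of_notMem h, indicator_of_notMem
      (fun h' => h ((smul_mem_annulus_iff hθ (le_of_lt hr)).1 h')), mul_zero]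

theorem sphereArea_pos {n : ℕ} (hn : 1 ≤ n) : 0 < sphereArea n := by
  have : NeZero n := ⟨by omega⟩
  refine ENNReal.toReal_pos ?_ (measure_ne_top _ _)
  rw [Ne, Measure.measure_univ_eq_zero]
  exact Measure.toSphere_ne_zero _

theorem ofReal_sphereArea (n : ℕ) :
    ENNReal.ofReal (sphereArea n) = (volume : Measure (Rn n)).toSphere univ :=
  ENNReal.ofReal_toReal (measure_ne_top _ _)

/-! ### The radial extremal problem -/

/-- The tangent line inequality for `t ↦ t ^ s` at `a`, cleared of subtractions. -/
theorem mul_rpow_sub_one_mul_le {a s : ℝ} (ha : 0 < a) (hs : 1 < s) (f : ℝ≥0∞) :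
    ENNReal.ofReal (s * a ^ (s - 1)) * f ≤ f ^ s + ENNReal.ofReal ((s - 1) * a ^ s) := by
  have hs0 : 0 < s := by linarith
  rcases eq_or_ne f ∞ with rfl | hf
  · rw [ENNReal.top_rpow_of_pos hs0]
    simp
  lift f to NNReal using hf
  obtain ⟨b, hb, e1⟩ : ∃ b : ℝ, 0 ≤ b ∧ (f : ℝ≥0∞) = ENNReal.ofReal b :=
    ⟨f, f.2, ENNReal.ofReal_coe_nnreal.symm⟩
  have key : s * a ^ (s - 1) * b ≤ b ^ s + (s - 1) * a ^ s := by
    have h := one_add_mul_self_le_rpow_one_add (s := b / a - 1)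
      (by have := div_nonneg hb ha.le; linarith) hs.le
    rw [add_sub_cancel, Real.div_rpow hb ha.le, le_div_iff₀ (Real.rpow_pos_of_pos ha s)] at h
    have e : a ^ s = a ^ (s - 1) * a := by
      rw [← Real.rpow_add_one ha.ne', sub_add_cancel]
    have : s * a ^ (s - 1) * b = s * (b / a) * a ^ s := by
      rw [e]; field_simp
    rw [this]
    linarith
  have has := Real.rpow_nonneg ha.le (s - 1)
  rw [e1, ENNReal.ofReal_rpow_of_nonneg hb hs0.le, ← ENNReal.ofReal_mul (by positivity),
    ← ENNReal.ofReal_add (by positivity)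
      (mul_nonneg (by linarith) (Real.rpow_nonneg ha.le s))]
  exact ENNReal.ofReal_le_ofReal key

/-- The properties of the radial profile `q` of a variable exponent on the annulus
`A(r₁, r₂)` that the computation of the modulus rests on: continuity, and the bounds
`1 < pm ≤ q ≤ pp`. -/
structure IsRadialExponent (q : ℝ → ℝ) (r₁ r₂ pm pp : ℝ) : Prop where
  pos : 0 < r₁
  lt : r₁ < r₂
  one_lt : 1 < pm
  continuousOn : ContinuousOn q (Ioo r₁ r₂)
  le : ∀ r ∈ Ioo r₁ r₂, pm ≤ q r
  ge : ∀ r ∈ Ioo r₁ r₂, q r ≤ pp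

namespace IsRadialExponent

variable {n : ℕ} {q : ℝ → ℝ} {r₁ r₂ pm pp lam : ℝ}

theorem one_lt_apply (h : IsRadialExponent q r₁ r₂ pm pp) {r : ℝ} (hr : r ∈ Ioo r₁ r₂) :
    1 < q r := h.one_lt.trans_le (h.le r hr)

theorem le_pp (h : IsRadialExponent q r₁ r₂ pm pp) : pm ≤ pp := by
  obtain ⟨r, hr⟩ := nonempty_Ioo.2 h.lt
  exact (h.le r hr).trans (h.ge r hr)

theorem weight_pos (h : IsRadialExponent q r₁ r₂ pm pp) (hn : 1 ≤ n) {r : ℝ}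
    (hr : r ∈ Ioo r₁ r₂) : 0 < q r * sphereArea n * r ^ (n - 1) := by
  have := h.one_lt_apply hr
  have := sphereArea_pos hn
  have := h.pos.trans hr.1
  positivity

theorem le_weight (h : IsRadialExponent q r₁ r₂ pm pp) (hn : 1 ≤ n) {r : ℝ}
    (hr : r ∈ Ioo r₁ r₂) :
    pm * sphereArea n * r₁ ^ (n - 1) ≤ q r * sphereArea n * r ^ (n - 1) := by
  have := h.one_lt_apply hr
  have := sphereArea_pos hn
  have := h.pos
  have := h.le r hr
  have := hr.1
  gcongr

theorem weight_le (h : IsRadialExponent q r₁ r₂ pm pp) (hn : 1 ≤ n) {r : ℝ}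
    (hr : r ∈ Ioo r₁ r₂) :
    q r * sphereArea n * r ^ (n - 1) ≤ pp * sphereArea n * r₂ ^ (n - 1) := by
  have := h.one_lt_apply hr
  have := sphereArea_pos hn
  have := h.pos
  have := h.ge r hr
  have := hr.1
  have := hr.2
  have := h.one_lt.trans_le h.le_pp
  have : 0 < r := by linarith
  gcongr

theorem rhoStar_pos (h : IsRadialExponent q r₁ r₂ pm pp) (hn : 1 ≤ n) (hlam : 0 < lam) {r : ℝ}
    (hr : r ∈ Ioo r₁ r₂) : 0 < rhoStar n q lam r :=
  Real.rpow_pos_of_pos (div_pos hlam (h.weight_pos hn hr)) _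

theorem continuousOn_rhoStar (h : IsRadialExponent q r₁ r₂ pm pp) (hn : 1 ≤ n) (hlam : 0 < lam) :
    ContinuousOn (rhoStar n q lam) (Ioo r₁ r₂) := by
  have hc := h.continuousOn
  unfold rhoStar
  refine ContinuousOn.rpow (continuousOn_const.div (by fun_prop) fun r hr =>
    (h.weight_pos hn hr).ne') (continuousOn_const.div (by fun_prop) fun r hr => ?_)
    fun r hr => Or.inl (div_pos hlam (h.weight_pos hn hr)).ne'
  have := h.one_lt_apply hr
  linarith

theorem exists_rhoStar_le (h : IsRadialExponent q r₁ r₂ pm pp) (hn : 1 ≤ n) (hlam : 0 < lam) :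
    ∃ K, ∀ r ∈ Ioo r₁ r₂, rhoStar n q lam r ≤ K := by
  have hω := sphereArea_pos hn
  have hr₁ := h.pos
  have hpm := h.one_lt
  refine ⟨(max 1 (lam / (pm * sphereArea n * r₁ ^ (n - 1)))) ^ (1 / (pm - 1)), fun r hr => ?_⟩
  have hq := h.one_lt_apply hr
  have hle := h.le r hr
  calc rhoStar n q lam r
      ≤ (max 1 (lam / (pm * sphereArea n * r₁ ^ (n - 1)))) ^ (1 / (q r - 1)) := by
        refine Real.rpow_le_rpow (div_pos hlam (h.weight_pos hn hr)).le
          (le_max_of_le_right ?_) (by have : 0 < q r - 1 := by linarith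
                                      positivity)
        have := h.le_weight hn hr
        gcongr
    _ ≤ _ := by
        refine Real.rpow_le_rpow_of_exponent_le (le_max_left _ _) ?_
        have : 0 < pm - 1 := by linarith
        gcongr

theorem integrableOn_rhoStar (h : IsRadialExponent q r₁ r₂ pm pp) (hn : 1 ≤ n)
    (hlam : 0 < lam) : IntegrableOn (rhoStar n q lam) (Ioo r₁ r₂) := by
  obtain ⟨K, hK⟩ := h.exists_rhoStar_le hn hlam
  refine IntegrableOn.of_bound (by simp)
    ((h.continuousOn_rhoStar hn hlam).aestronglyMeasurable measurableSet_Ioo) K ?_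
  filter_upwards [ae_restrict_mem measurableSet_Ioo] with r hr
  rw [Real.norm_of_nonneg (h.rhoStar_pos hn hlam hr).le]
  exact hK r hr

theorem continuousOn_rhoStar_rpow (h : IsRadialExponent q r₁ r₂ pm pp) (hn : 1 ≤ n)
    (hlam : 0 < lam) : ContinuousOn (fun r => rhoStar n q lam r ^ q r) (Ioo r₁ r₂) :=
  (h.continuousOn_rhoStar hn hlam).rpow h.continuousOn
    fun _ hr => Or.inl (h.rhoStar_pos hn hlam hr).ne'

/-- The Euler–Lagrange equation of the radial problem: at `rhoStar` the derivative of the energy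
density `t ↦ r ^ (n - 1) * t ^ q r` is the same for all radii `r`. -/
theorem mul_rhoStar_rpow_sub_one (h : IsRadialExponent q r₁ r₂ pm pp) (hn : 1 ≤ n)
    (hlam : 0 < lam) {r : ℝ} (hr : r ∈ Ioo r₁ r₂) :
    r ^ (n - 1) * (q r * rhoStar n q lam r ^ (q r - 1)) = lam / sphereArea n := by
  have hw := h.weight_pos hn hr
  have hq : q r - 1 ≠ 0 := by have := h.one_lt_apply hr; linarith
  have hq0 : q r ≠ 0 := by have := h.one_lt_apply hr; linarith
  have hr0 : r ≠ 0 := (h.pos.trans hr.1).ne'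
  have hω := (sphereArea_pos hn).ne'
  rw [rhoStar, ← Real.rpow_mul (div_pos hlam hw).le, one_div, inv_mul_cancel₀ hq, Real.rpow_one]
  field_simp

theorem mul_rhoStar_rpow (h : IsRadialExponent q r₁ r₂ pm pp) (hn : 1 ≤ n)
    (hlam : 0 < lam) {r : ℝ} (hr : r ∈ Ioo r₁ r₂) :
    r ^ (n - 1) * (q r * rhoStar n q lam r ^ q r) =
      lam / sphereArea n * rhoStar n q lam r := by
  rw [← h.mul_rhoStar_rpow_sub_one hn hlam hr, mul_assoc, mul_assoc,
    ← Real.rpow_add_one (h.rhoStar_pos hn hlam hr).ne', sub_add_cancel]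

theorem integrableOn_rhoStar_rpow_mul (h : IsRadialExponent q r₁ r₂ pm pp) (hn : 1 ≤ n)
    (hlam : 0 < lam) :
    IntegrableOn (fun r => rhoStar n q lam r ^ q r * r ^ (n - 1)) (Ioo r₁ r₂) := by
  refine Integrable.mono' ((h.integrableOn_rhoStar hn hlam).const_mul (lam / sphereArea n))
    (((h.continuousOn_rhoStar_rpow hn hlam).mul (by fun_prop)).aestronglyMeasurable
      measurableSet_Ioo) ?_
  filter_upwards [ae_restrict_mem measurableSet_Ioo] with r hr
  have h1 := (Real.rpow_pos_of_pos (h.rhoStar_pos hn hlam hr) (q r)).le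
  have h2 := (pow_pos (h.pos.trans hr.1) (n - 1)).le
  rw [Real.norm_of_nonneg (mul_nonneg h1 h2), ← h.mul_rhoStar_rpow hn hlam hr, mul_comm]
  refine mul_le_mul_of_nonneg_left ?_ h2
  exact le_mul_of_one_le_left h1 (h.one_lt_apply hr).le

theorem rhoStar_mono (h : IsRadialExponent q r₁ r₂ pm pp) (hn : 1 ≤ n) {lam' : ℝ}
    (hlam : 0 < lam) (hle : lam ≤ lam') {r : ℝ} (hr : r ∈ Ioo r₁ r₂) :
    rhoStar n q lam r ≤ rhoStar n q lam' r := by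
  have hq := h.one_lt_apply hr
  have hw := h.weight_pos hn hr
  refine Real.rpow_le_rpow (by positivity) (by gcongr) ?_
  rw [one_div, inv_nonneg]
  linarith

/-- Raising the multiplier by a factor `t ≥ 1` raises `rhoStar` by a definite factor. -/
theorem mul_rhoStar_le (h : IsRadialExponent q r₁ r₂ pm pp) (hn : 1 ≤ n) {t : ℝ}
    (hlam : 0 < lam) (ht : 1 ≤ t) {r : ℝ} (hr : r ∈ Ioo r₁ r₂) :
    t ^ (1 / (pp - 1)) * rhoStar n q lam r ≤ rhoStar n q (t * lam) r := by
  have hq := h.one_lt_apply hr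
  have hw := h.weight_pos hn hr
  have hge := h.ge r hr
  have hq' : 0 < q r - 1 := by linarith
  rw [rhoStar, rhoStar, mul_div_assoc, Real.mul_rpow (by linarith) (by positivity)]
  gcongr

theorem multiplier_unique (h : IsRadialExponent q r₁ r₂ pm pp) (hn : 1 ≤ n) {lam' : ℝ}
    (hl : IsMultiplier n q r₁ r₂ lam) (hl' : IsMultiplier n q r₁ r₂ lam') : lam = lam' := by
  wlog hlt : lam < lam' generalizing lam lam'
  · rcases eq_or_lt_of_le (not_lt.1 hlt) with e | e
    · exact e.symm
    · exact (this hl' hl e).symm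
  exfalso
  obtain ⟨h0, hi, he⟩ := hl
  obtain ⟨h0', hi', he'⟩ := hl'
  have ht : 1 < lam' / lam := (one_lt_div h0).2 hlt
  have hle : ∫ r in Ioo r₁ r₂, (lam' / lam) ^ (1 / (pp - 1)) * rhoStar n q lam r ≤
      ∫ r in Ioo r₁ r₂, rhoStar n q lam' r := by
    refine setIntegral_mono_on (hi.const_mul _) hi' measurableSet_Ioo fun r hr => ?_
    have := h.mul_rhoStar_le hn h0 ht.le hr
    rwa [div_mul_cancel₀ _ h0.ne'] at this
  rw [integral_const_mul, he, he', mul_one] at hle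
  have := h.one_lt.trans_le h.le_pp
  exact absurd hle (not_le.2 (Real.one_lt_rpow ht (by
    rw [one_div, inv_pos]; linarith)))

theorem continuousOn_integral_rhoStar (h : IsRadialExponent q r₁ r₂ pm pp) (hn : 1 ≤ n)
    {M : ℝ} (hM : 0 < M) :
    ContinuousOn (fun lam => ∫ r in Ioo r₁ r₂, rhoStar n q lam r) (Ioc 0 M) := by
  refine continuousOn_of_dominated (bound := rhoStar n q M) (fun lam hl => ?_) (fun lam hl => ?_)
    (h.integrableOn_rhoStar hn hM) ?_
  · exact (h.continuousOn_rhoStar hn hl.1).aestronglyMeasurable measurableSet_Ioo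
  · filter_upwards [ae_restrict_mem measurableSet_Ioo] with r hr
    rw [Real.norm_of_nonneg (h.rhoStar_pos hn hl.1 hr).le]
    exact h.rhoStar_mono hn hl.1 hl.2 hr
  · filter_upwards [ae_restrict_mem measurableSet_Ioo] with r hr lam hl
    refine ContinuousAt.continuousWithinAt ?_
    have hw := h.weight_pos hn hr
    unfold rhoStar
    exact (continuousAt_id.div_const _).rpow_const (Or.inl (div_pos hl.1 hw).ne')

theorem rhoStar_le_of_le (h : IsRadialExponent q r₁ r₂ pm pp) (hn : 1 ≤ n) (hlam : 0 < lam)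
    {t r : ℝ} (ht : 0 < t) (hr : r ∈ Ioo r₁ r₂)
    (hle : lam ≤ t ^ (q r - 1) * (q r * sphereArea n * r ^ (n - 1))) :
    rhoStar n q lam r ≤ t := by
  have hq : 0 < q r - 1 := by have := h.one_lt_apply hr; linarith
  have hw := h.weight_pos hn hr
  rw [rhoStar, one_div, Real.rpow_inv_le_iff_of_pos (by positivity) ht.le hq]
  exact (div_le_iff₀ hw).2 hle

theorem le_rhoStar_of_le (h : IsRadialExponent q r₁ r₂ pm pp) (hn : 1 ≤ n) (hlam : 0 < lam)
    {t r : ℝ} (ht : 0 < t) (hr : r ∈ Ioo r₁ r₂)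
    (hle : t ^ (q r - 1) * (q r * sphereArea n * r ^ (n - 1)) ≤ lam) :
    t ≤ rhoStar n q lam r := by
  have hq : 0 < q r - 1 := by have := h.one_lt_apply hr; linarith
  have hw := h.weight_pos hn hr
  rw [rhoStar, one_div, Real.le_rpow_inv_iff_of_pos ht.le (by positivity) hq]
  exact (le_div_iff₀ hw).2 hle

theorem exists_isMultiplier (h : IsRadialExponent q r₁ r₂ pm pp) (hn : 1 ≤ n) :
    ∃ lam, IsMultiplier n q r₁ r₂ lam := by
  have hω := sphereArea_pos hn
  have hr₁ := h.pos
  have hr₂ := h.pos.trans h.lt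
  have hpm := h.one_lt
  have hpp := h.one_lt.trans_le h.le_pp
  have hd : 0 < r₂ - r₁ := sub_pos.2 h.lt
  set t : ℝ := (r₂ - r₁)⁻¹ with ht_def
  have ht : 0 < t := inv_pos.2 hd
  have hconst : ∫ _ in Ioo r₁ r₂, t = 1 := by
    rw [setIntegral_const, Measure.real, Real.volume_Ioo, ENNReal.toReal_ofReal hd.le, smul_eq_mul,
      ht_def, mul_inv_cancel₀ hd.ne']
  have hti : IntegrableOn (fun _ : ℝ => t) (Ioo r₁ r₂) := integrableOn_const (by simp)
  -- The two multipliers make `rhoStar` at most `t`, respectively at least `t`, on `(r₁, r₂)`.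
  set a : ℝ := min (t ^ (pm - 1)) (t ^ (pp - 1)) * (pm * sphereArea n * r₁ ^ (n - 1))
  set b : ℝ := max (t ^ (pm - 1)) (t ^ (pp - 1)) * (pp * sphereArea n * r₂ ^ (n - 1))
  have ha : 0 < a := by positivity
  have hb : 0 < b := by positivity
  have hlow : ∀ r ∈ Ioo r₁ r₂, rhoStar n q a r ≤ t := fun r hr => by
    refine h.rhoStar_le_of_le hn ha ht hr ?_
    refine mul_le_mul ?_ (h.le_weight hn hr) (by positivity) (by positivity)
    rcases le_total 1 t with h1 | h1
    · exact (min_le_left _ _).trans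
        (Real.rpow_le_rpow_of_exponent_le h1 (by linarith [h.le r hr]))
    · exact (min_le_right _ _).trans
        (Real.rpow_le_rpow_of_exponent_ge ht h1 (by linarith [h.ge r hr]))
  have hupp : ∀ r ∈ Ioo r₁ r₂, t ≤ rhoStar n q b r := fun r hr => by
    refine h.le_rhoStar_of_le hn hb ht hr ?_
    refine mul_le_mul ?_ (h.weight_le hn hr) (h.weight_pos hn hr).le (by positivity)
    rcases le_total 1 t with h1 | h1
    · exact (Real.rpow_le_rpow_of_exponent_le h1 (by linarith [h.ge r hr])).trans
        (le_max_right _ _)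
    · exact (Real.rpow_le_rpow_of_exponent_ge ht h1 (by linarith [h.le r hr])).trans
        (le_max_left _ _)
  have hM : 0 < max a b := lt_max_of_lt_left ha
  obtain ⟨lam, hl, he⟩ := isPreconnected_Ioc.intermediate_value
    (⟨ha, le_max_left _ _⟩ : a ∈ Ioc 0 (max a b)) ⟨hb, le_max_right _ _⟩
    (h.continuousOn_integral_rhoStar hn hM)
    (⟨hconst ▸ setIntegral_mono_on (h.integrableOn_rhoStar hn ha) hti measurableSet_Ioo hlow,
      hconst ▸ setIntegral_mono_on hti (h.integrableOn_rhoStar hn hb) measurableSet_Ioo hupp⟩ :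
      (1 : ℝ) ∈ Icc _ _)
  exact ⟨lam, hl.1, h.integrableOn_rhoStar hn hl.1, he⟩

theorem existsUnique_isMultiplier (h : IsRadialExponent q r₁ r₂ pm pp) (hn : 1 ≤ n) :
    ∃! lam, IsMultiplier n q r₁ r₂ lam := by
  obtain ⟨lam, hl⟩ := h.exists_isMultiplier hn
  exact ⟨lam, hl, fun _ hl' => h.multiplier_unique hn hl' hl⟩

theorem lintegral_rhoStar (h : IsRadialExponent q r₁ r₂ pm pp) (hn : 1 ≤ n)
    (hl : IsMultiplier n q r₁ r₂ lam) :
    ∫⁻ r in Ioo r₁ r₂, ENNReal.ofReal (rhoStar n q lam r) = 1 := by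
  rw [← ofReal_integral_eq_lintegral_ofReal hl.2.1, hl.2.2, ENNReal.ofReal_one]
  filter_upwards [ae_restrict_mem measurableSet_Ioo] with r hr
  exact (h.rhoStar_pos hn hl.1 hr).le

/-- The density `rhoStar` minimizes the radial energy. The tangent line inequality at `rhoStar`
bounds the energy density of `f` below by an affine function of `f`, whose slope is the constant
`lam / ω` by the Euler–Lagrange equation. -/
theorem energy_rhoStar_le (h : IsRadialExponent q r₁ r₂ pm pp) (hn : 1 ≤ n)
    (hl : IsMultiplier n q r₁ r₂ lam) {f : ℝ → ℝ≥0∞} (hf : 1 ≤ ∫⁻ r in Ioo r₁ r₂, f r) :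
    ∫⁻ r in Ioo r₁ r₂, ENNReal.ofReal (rhoStar n q lam r ^ q r * r ^ (n - 1)) ≤
      ∫⁻ r in Ioo r₁ r₂, ENNReal.ofReal (r ^ (n - 1)) * f r ^ q r := by
  have hlam := hl.1
  have hω := sphereArea_pos hn
  have hqc := h.continuousOn
  have hρc := h.continuousOn_rhoStar_rpow hn hlam
  have hpow : ∀ r ∈ Ioo r₁ r₂, 0 ≤ r ^ (n - 1) := fun r hr =>
    (pow_pos (h.pos.trans hr.1) (n - 1)).le
  have hrho : ∀ r ∈ Ioo r₁ r₂, 0 ≤ rhoStar n q lam r ^ q r := fun r hr =>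
    Real.rpow_nonneg (h.rhoStar_pos hn hlam hr).le _
  have hq : ∀ r ∈ Ioo r₁ r₂, 0 ≤ q r - 1 := fun r hr => by
    have := h.one_lt_apply hr; linarith
  set g : ℝ → ℝ≥0∞ := fun r =>
    ENNReal.ofReal (r ^ (n - 1) * ((q r - 1) * rhoStar n q lam r ^ q r))
  have hg : AEMeasurable g (volume.restrict (Ioo r₁ r₂)) := by
    refine ENNReal.measurable_ofReal.comp_aemeasurable ?_
    exact ContinuousOn.aemeasurable (by fun_prop) measurableSet_Ioo
  have hsum : (∫⁻ r in Ioo r₁ r₂, ENNReal.ofReal (rhoStar n q lam r ^ q r * r ^ (n - 1))) +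
      ∫⁻ r in Ioo r₁ r₂, g r = ENNReal.ofReal (lam / sphereArea n) := by
    rw [← lintegral_add_right' _ hg]
    calc _ = ∫⁻ r in Ioo r₁ r₂,
          ENNReal.ofReal (lam / sphereArea n) * ENNReal.ofReal (rhoStar n q lam r) := by
          refine setLIntegral_congr_fun measurableSet_Ioo fun r hr => ?_
          change ENNReal.ofReal _ + ENNReal.ofReal _ = _
          rw [← ENNReal.ofReal_add (mul_nonneg (hrho r hr) (hpow r hr))
            (mul_nonneg (hpow r hr) (mul_nonneg (hq r hr) (hrho r hr))),
            ← ENNReal.ofReal_mul (by positivity), ← h.mul_rhoStar_rpow hn hlam hr]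
          congr 1
          ring
      _ = _ := by
          rw [lintegral_const_mul' _ _ ENNReal.ofReal_ne_top, h.lintegral_rhoStar hn hl, mul_one]
  have hgtop : ∫⁻ r in Ioo r₁ r₂, g r ≠ ⊤ :=
    ne_top_of_le_ne_top ENNReal.ofReal_ne_top (le_add_self.trans_eq hsum)
  -- The part `g` of the energy of `rhoStar` is finite and cancels.
  refine (ENNReal.add_le_add_iff_right hgtop).1 ?_
  calc _ = ENNReal.ofReal (lam / sphereArea n) * 1 := by rw [hsum, mul_one]
    _ ≤ ENNReal.ofReal (lam / sphereArea n) * ∫⁻ r in Ioo r₁ r₂, f r := by gcongr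
    _ = ∫⁻ r in Ioo r₁ r₂, ENNReal.ofReal (lam / sphereArea n) * f r :=
        (lintegral_const_mul' _ _ ENNReal.ofReal_ne_top).symm
    _ ≤ ∫⁻ r in Ioo r₁ r₂, (ENNReal.ofReal (r ^ (n - 1)) * f r ^ q r + g r) := by
        refine setLIntegral_mono' measurableSet_Ioo fun r hr => ?_
        change _ ≤ _ + ENNReal.ofReal _
        rw [← h.mul_rhoStar_rpow_sub_one hn hlam hr, ENNReal.ofReal_mul (hpow r hr),
          ENNReal.ofReal_mul (hpow r hr), mul_assoc, ← mul_add]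
        gcongr
        exact mul_rpow_sub_one_mul_le (h.rhoStar_pos hn hlam hr) (h.one_lt_apply hr) (f r)
    _ = _ := lintegral_add_right' _ hg

end IsRadialExponent

/-! ### Radial log-Hölder exponents -/

theorem LogHolderOn.continuousOn {n : ℕ} {K : ℝ} {p : Rn n → ℝ} {Ω : Set (Rn n)}
    (h : LogHolderOn K p Ω) : ContinuousOn p Ω := by
  intro x hx
  rw [← continuousWithinAt_sdiff_self, ContinuousWithinAt, tendsto_iff_dist_tendsto_zero]
  have hd : Tendsto (fun y => dist y x) (𝓝[Ω \ {x}] x) (𝓝[>] 0) := by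
    refine tendsto_nhdsWithin_iff.2 ⟨?_, ?_⟩
    · have : Tendsto (fun y => dist y x) (𝓝 x) (𝓝 (dist x x)) :=
        (continuous_id.dist continuous_const).tendsto x
      rw [dist_self] at this
      exact this.mono_left nhdsWithin_le_nhds
    · filter_upwards [self_mem_nhdsWithin] with y hy
      exact dist_pos.2 hy.2
  have hlog : Tendsto (fun y => Real.log (Real.exp 1 + 1 / dist y x)) (𝓝[Ω \ {x}] x) atTop := by
    refine Real.tendsto_log_atTop.comp (tendsto_atTop_add_const_left _ _ ?_)
    simp only [one_div]
    exact tendsto_inv_nhdsGT_zero.comp hd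
  refine squeeze_zero' (Eventually.of_forall fun _ => dist_nonneg) ?_ (hlog.const_div_atTop K)
  filter_upwards [self_mem_nhdsWithin] with y hy
  exact h.2 y hy.1 x hx

/-- A closed condition on a function continuous on an open set that holds almost everywhere there
holds everywhere there. -/
theorem forall_mem_of_ae_restrict {X Y : Type*} [TopologicalSpace X] [MeasurableSpace X]
    [OpensMeasurableSpace X] [TopologicalSpace Y] {μ : Measure X} [μ.IsOpenPosMeasure]
    {U : Set X} (hU : IsOpen U) {f : X → Y} (hf : ContinuousOn f U) {S : Set Y} (hS : IsClosed S)
    (h : ∀ᵐ x ∂μ.restrict U, f x ∈ S) : ∀ x ∈ U, f x ∈ S := by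
  intro x hx
  by_contra hxS
  have hopen : IsOpen (U ∩ f ⁻¹' Sᶜ) := hf.isOpen_inter_preimage hU hS.isOpen_compl
  refine hopen.measure_ne_zero μ ⟨x, hx, hxS⟩ ?_
  rw [ae_restrict_iff' hU.measurableSet] at h
  exact measure_mono_null (fun y hy => fun hc => hy.2 (hc hy.1)) h

theorem isRadialExponent_of_logHolderOn {n : ℕ} (hn : 1 ≤ n) {pm pp K r₁ r₂ : ℝ} (hpm : 1 < pm)
    (h₁ : 0 < r₁) (h₂ : r₁ < r₂) {p : Rn n → ℝ} {q : ℝ → ℝ}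
    (hpq : ∀ x ∈ annulus n r₁ r₂, p x = q ‖x‖) (hlog : LogHolderOn K p (annulus n r₁ r₂))
    (hm : pMinus p (annulus n r₁ r₂) = (pm : EReal))
    (hp : pPlus p (annulus n r₁ r₂) = (pp : EReal)) : IsRadialExponent q r₁ r₂ pm pp := by
  have hA := isOpen_annulus n r₁ r₂
  have hc := hlog.continuousOn
  have hle : ∀ x ∈ annulus n r₁ r₂, p x ∈ Ici pm := by
    refine forall_mem_of_ae_restrict (μ := volume) hA hc isClosed_Ici ?_
    filter_upwards [ae_essInf_le (f := fun x => (p x : EReal))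
      (μ := volume.restrict (annulus n r₁ r₂))] with x hx
    exact EReal.coe_le_coe_iff.1 (hm.symm.trans_le hx)
  have hge : ∀ x ∈ annulus n r₁ r₂, p x ∈ Iic pp := by
    refine forall_mem_of_ae_restrict (μ := volume) hA hc isClosed_Iic ?_
    filter_upwards [ae_le_essSup (f := fun x => (p x : EReal))
      (μ := volume.restrict (annulus n r₁ r₂))] with x hx
    exact EReal.coe_le_coe_iff.1 (hx.trans_eq hp)
  obtain ⟨θ, hθ⟩ : ∃ θ : Rn n, ‖θ‖ = 1 :=
    ⟨EuclideanSpace.single ⟨0, hn⟩ 1, by simp⟩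
  have hmem : ∀ r ∈ Ioo r₁ r₂, r • θ ∈ annulus n r₁ r₂ := fun r hr =>
    (smul_mem_annulus_iff hθ (h₁.trans hr.1).le).2 hr
  have hq : ∀ r ∈ Ioo r₁ r₂, q r = p (r • θ) := fun r hr => by
    rw [hpq _ (hmem r hr), norm_smul, hθ, mul_one, Real.norm_of_nonneg (h₁.trans hr.1).le]
  refine ⟨h₁, h₂, hpm, ?_, fun r hr => ?_, fun r hr => ?_⟩
  · exact (hc.comp (by fun_prop) hmem).congr hq
  · rw [hq r hr]; exact hle _ (hmem r hr)
  · rw [hq r hr]; exact hge _ (hmem r hr)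

/-! ### Modulus and capacity of an annulus -/

theorem lintegral_annulus_rpow {n : ℕ} (hn : 1 ≤ n) {r₁ r₂ : ℝ} (h₁ : 0 < r₁) {p : Rn n → ℝ}
    {q : ℝ → ℝ} (hpq : ∀ x ∈ annulus n r₁ r₂, p x = q ‖x‖)
    (hc : ContinuousOn p (annulus n r₁ r₂)) {G : Rn n → ℝ≥0∞} (hG : Measurable G) :
    ∫⁻ x in annulus n r₁ r₂, G x ^ p x = ∫⁻ θ : Metric.sphere (0 : Rn n) 1,
      (∫⁻ r in Ioo r₁ r₂, ENNReal.ofReal (r ^ (n - 1)) * G (r • (θ : Rn n)) ^ q r)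
        ∂(volume : Measure (Rn n)).toSphere := by
  classical
  have hA := (isOpen_annulus n r₁ r₂).measurableSet
  -- `p` is arbitrary off the annulus, so a globally measurable exponent replaces it.
  have hp : Measurable ((annulus n r₁ r₂).piecewise p 0) :=
    hc.measurable_piecewise continuousOn_const hA
  calc ∫⁻ x in annulus n r₁ r₂, G x ^ p x
      = ∫⁻ x in annulus n r₁ r₂, G x ^ (annulus n r₁ r₂).piecewise p 0 x :=
        setLIntegral_congr_fun hA fun x hx => by
          simp only [piecewise_eq_of_mem _ _ _ hx]
    _ = _ := by
        rw [lintegral_annulus hn h₁ (hG.pow hp)]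
        refine lintegral_congr fun θ => setLIntegral_congr_fun measurableSet_Ioo fun r hr => ?_
        have hθ : ‖(θ : Rn n)‖ = 1 := by simp
        have hr0 := (h₁.trans hr.1).le
        have hmem := (smul_mem_annulus_iff hθ hr0).2 hr
        simp only [piecewise_eq_of_mem _ _ _ hmem, hpq _ hmem, norm_smul, hθ, mul_one,
          Real.norm_of_nonneg hr0]

theorem IsRadialExponent.ofReal_sphereArea_mul_energy {n : ℕ} {q : ℝ → ℝ} {r₁ r₂ pm pp lam : ℝ}
    (h : IsRadialExponent q r₁ r₂ pm pp) (hn : 1 ≤ n) (hlam : 0 < lam) :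
    ENNReal.ofReal (sphereArea n *
        ∫ r in Ioo r₁ r₂, rhoStar n q lam r ^ q r * r ^ (n - 1)) =
      ∫⁻ _ : Metric.sphere (0 : Rn n) 1, (∫⁻ r in Ioo r₁ r₂,
        ENNReal.ofReal (rhoStar n q lam r ^ q r * r ^ (n - 1)))
        ∂(volume : Measure (Rn n)).toSphere := by
  rw [lintegral_const, ENNReal.ofReal_mul (sphereArea_pos hn).le, ofReal_sphereArea, mul_comm,
    ofReal_integral_eq_lintegral_ofReal (h.integrableOn_rhoStar_rpow_mul hn hlam)]
  filter_upwards [ae_restrict_mem measurableSet_Ioo] with r hr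
  exact mul_nonneg (Real.rpow_nonneg (h.rhoStar_pos hn hlam hr).le _)
    (pow_pos (h.pos.trans hr.1) _).le

/-- Any density whose integral over each radial segment of the annulus is at least `1` has at
least the energy of the radial density `rhoStar`. -/
theorem IsRadialExponent.le_lintegral_rpow {n : ℕ} {q : ℝ → ℝ} {r₁ r₂ pm pp lam : ℝ}
    (h : IsRadialExponent q r₁ r₂ pm pp) (hn : 1 ≤ n) {p : Rn n → ℝ}
    (hpq : ∀ x ∈ annulus n r₁ r₂, p x = q ‖x‖)
    (hc : ContinuousOn p (annulus n r₁ r₂)) (hl : IsMultiplier n q r₁ r₂ lam)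
    {G : Rn n → ℝ≥0∞} (hG : Measurable G)
    (hG1 : ∀ θ : Rn n, ‖θ‖ = 1 → 1 ≤ ∫⁻ r in Ioo r₁ r₂, G (r • θ)) :
    ENNReal.ofReal (sphereArea n *
        ∫ r in Ioo r₁ r₂, rhoStar n q lam r ^ q r * r ^ (n - 1)) ≤
      ∫⁻ x in annulus n r₁ r₂, G x ^ p x := by
  rw [h.ofReal_sphereArea_mul_energy hn hl.1, lintegral_annulus_rpow hn h.pos hpq hc hG]
  exact lintegral_mono fun θ => h.energy_rhoStar_le hn hl (hG1 θ (by simp))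

theorem IsRadialExponent.modulus_eq {n : ℕ} {q : ℝ → ℝ} {r₁ r₂ pm pp lam : ℝ}
    (h : IsRadialExponent q r₁ r₂ pm pp) (hn : 1 ≤ n) {p : Rn n → ℝ}
    (hpq : ∀ x ∈ annulus n r₁ r₂, p x = q ‖x‖)
    (hc : ContinuousOn p (annulus n r₁ r₂)) (hl : IsMultiplier n q r₁ r₂ lam) :
    modulus p (annulus n r₁ r₂)
        (joiningCurves (Metric.sphere 0 r₁) (Metric.sphere 0 r₂) (annulus n r₁ r₂)) =
      ENNReal.ofReal (sphereArea n *
        ∫ r in Ioo r₁ r₂, rhoStar n q lam r ^ q r * r ^ (n - 1)) := by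
  classical
  refine le_antisymm ?_ (le_iInf₂ fun ρ hρ => ?_)
  -- Nothing is known about `q` off `(r₁, r₂)`: the cut-off makes the density Borel.
  · set φ : ℝ → ℝ≥0∞ := (Ioo r₁ r₂).piecewise (fun r => ENNReal.ofReal (rhoStar n q lam r)) 0
    have hφ : Measurable φ :=
      (ENNReal.continuous_ofReal.comp_continuousOn
        (h.continuousOn_rhoStar hn hl.1)).measurable_piecewise continuousOn_const measurableSet_Ioo
    have hφr : ∀ r ∈ Ioo r₁ r₂, φ r = ENNReal.ofReal (rhoStar n q lam r) := fun r hr =>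
      piecewise_eq_of_mem _ _ _ hr
    have hφn : Measurable fun x : Rn n => φ ‖x‖ := hφ.comp measurable_norm
    have hadm : (fun x : Rn n => φ ‖x‖) ∈ admissible
        (joiningCurves (Metric.sphere 0 r₁) (Metric.sphere 0 r₂) (annulus n r₁ r₂)) := by
      refine ⟨hφn, fun γ hγ _ => le_trans (le_of_eq ?_) (lintegral_Ioo_le_lineIntegral hγ hφ)⟩
      rw [setLIntegral_congr_fun measurableSet_Ioo hφr, h.lintegral_rhoStar hn hl]
    refine (iInf₂_le _ hadm).trans_eq ?_
    rw [lintegral_annulus_rpow hn h.pos hpq hc hφn, h.ofReal_sphereArea_mul_energy hn hl.1]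
    refine lintegral_congr fun θ => setLIntegral_congr_fun measurableSet_Ioo fun r hr => ?_
    have hr0 := h.pos.trans hr.1
    have hnorm : ‖r • (θ : Rn n)‖ = r := by simp [norm_smul, abs_of_pos hr0]
    simp only [hnorm, hφr r hr]
    rw [ENNReal.ofReal_rpow_of_pos (h.rhoStar_pos hn hl.1 hr),
      ← ENNReal.ofReal_mul (pow_pos hr0 _).le, mul_comm]
  · exact h.le_lintegral_rpow hn hpq hc hl hρ.1 fun θ hθ =>
      (hρ.2 _ (radialCurve_mem_joiningCurves hθ h.pos h.lt)
        (radialCurve_mem_joiningCurves hθ h.pos h.lt).1).trans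
        (lineIntegral_radialCurve_le hθ h.lt ρ)

theorem continuous_gradient {n : ℕ} {u : Rn n → ℝ} (hu : ContDiff ℝ ∞ u) :
    Continuous (gradient u) :=
  (InnerProductSpace.toDual ℝ (Rn n)).symm.continuous.comp (hu.continuous_fderiv (by simp))

theorem one_le_lintegral_gradient {n : ℕ} {r₁ r₂ : ℝ} (h₁ : 0 < r₁) (h : r₁ < r₂) {Ω : Set (Rn n)}
    {u : Rn n → ℝ} (hu : u ∈ capTest (Metric.closedBall 0 r₁) (Metric.ball 0 r₂)ᶜ Ω) {θ : Rn n}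
    (hθ : ‖θ‖ = 1) : 1 ≤ ∫⁻ r in Ioo r₁ r₂, ‖gradient u (r • θ)‖ₑ := by
  obtain ⟨hsm, -, -, hE, hF⟩ := hu
  have hnorm : ∀ r : ℝ, 0 < r → ‖r • θ‖ = r := fun r hr => by
    rw [norm_smul, hθ, mul_one, Real.norm_of_nonneg hr.le]
  have hu₁ : 1 ≤ u (r₁ • θ) := hE _ (by simp [hnorm r₁ h₁])
  have hu₂ : u (r₂ • θ) ≤ 0 := hF _ (by simp [hnorm r₂ (h₁.trans h)])
  have hderiv : ∀ r : ℝ, HasDerivAt (fun r : ℝ => u (r • θ)) (fderiv ℝ u (r • θ) θ) r := by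
    intro r
    have h1 : HasFDerivAt u (fderiv ℝ u (r • θ)) (r • θ) :=
      (hsm.differentiable (by simp) _).hasFDerivAt
    have h2 : HasDerivAt (fun r : ℝ => r • θ) θ r := by
      simpa using (hasDerivAt_id r).smul_const θ
    exact h1.comp_hasDerivAt r h2
  have hcont : Continuous fun r : ℝ => fderiv ℝ u (r • θ) θ := by
    have := hsm.continuous_fderiv (by simp)
    fun_prop
  have hint := intervalIntegral.integral_eq_sub_of_hasDerivAt (a := r₁) (b := r₂)
    (fun r _ => hderiv r) (hcont.intervalIntegrable _ _)
  rw [intervalIntegral.integral_of_le h.le, integral_Ioc_eq_integral_Ioo] at hint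
  calc (1 : ℝ≥0∞) ≤ ‖∫ r in Ioo r₁ r₂, fderiv ℝ u (r • θ) θ‖ₑ := by
        rw [← ofReal_norm, hint, ENNReal.one_le_ofReal, Real.norm_eq_abs, le_abs]
        right
        linarith
    _ ≤ ∫⁻ r in Ioo r₁ r₂, ‖fderiv ℝ u (r • θ) θ‖ₑ := enorm_integral_le_lintegral_enorm _
    _ ≤ ∫⁻ r in Ioo r₁ r₂, ‖gradient u (r • θ)‖ₑ := by
        refine lintegral_mono fun r => ?_
        rw [enorm_le_iff_norm_le, gradient, LinearIsometryEquiv.norm_map]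
        simpa [hθ] using (fderiv ℝ u (r • θ)).le_opNorm θ

end VarExp

/-- The constant `C` is chosen after `n, p⁻, p⁺, C_log` only. -/
theorem corollary8p4 (n : ℕ) (hn : 1 ≤ n) (pm pp Clog : ℝ) (hpm : 1 < pm) :
    ∃ C : ℝ, 0 < C ∧
      ∀ (r₁ r₂ : ℝ), 0 < r₁ → r₁ < r₂ →
      ∀ (p : VarExp.Rn n → ℝ) (q : ℝ → ℝ),
        (∀ x ∈ VarExp.annulus n r₁ r₂, 1 < p x) →
        (∀ x ∈ VarExp.annulus n r₁ r₂, p x = q ‖x‖) →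
        VarExp.LogHolderOn Clog p (VarExp.annulus n r₁ r₂) →
        VarExp.pMinus p (VarExp.annulus n r₁ r₂) = (pm : EReal) →
        VarExp.pPlus p (VarExp.annulus n r₁ r₂) = (pp : EReal) →
        -- capacity bounded below by the modulus of the curves joining the two spheres
        ENNReal.ofReal (1 / C) *
            VarExp.modulus p (VarExp.annulus n r₁ r₂)
              (VarExp.joiningCurves (Metric.sphere 0 r₁) (Metric.sphere 0 r₂)
                (VarExp.annulus n r₁ r₂))
          ≤ VarExp.capacity p (Metric.closedBall 0 r₁) (Metric.ball 0 r₂)ᶜ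
              (VarExp.annulus n r₁ r₂) ∧
        -- the modulus in terms of the explicit density
        (∃! lam : ℝ, VarExp.IsMultiplier n q r₁ r₂ lam) ∧
        ∀ lam : ℝ, VarExp.IsMultiplier n q r₁ r₂ lam →
          IntegrableOn (fun r => VarExp.rhoStar n q lam r ^ q r * r ^ (n - 1)) (Ioo r₁ r₂) ∧
          VarExp.modulus p (VarExp.annulus n r₁ r₂)
              (VarExp.joiningCurves (Metric.sphere 0 r₁) (Metric.sphere 0 r₂)
                (VarExp.annulus n r₁ r₂))
            = ENNReal.ofReal (VarExp.sphereArea n *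
                ∫ r in Ioo r₁ r₂, VarExp.rhoStar n q lam r ^ q r * r ^ (n - 1)) := by
  refine ⟨1, one_pos, fun r₁ r₂ h₁ h₂ p q _ hpq hlog hm hp => ?_⟩
  have hc := hlog.continuousOn
  have h := VarExp.isRadialExponent_of_logHolderOn hn hpm h₁ h₂ hpq hlog hm hp
  have hex := h.existsUnique_isMultiplier hn
  refine ⟨?_, hex, fun lam hl =>
    ⟨h.integrableOn_rhoStar_rpow_mul hn hl.1, h.modulus_eq hn hpq hc hl⟩⟩
  obtain ⟨lam, hl, -⟩ := hex
  rw [div_one, ENNReal.ofReal_one, one_mul, h.modulus_eq hn hpq hc hl]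
  exact le_iInf₂ fun u hu => h.le_lintegral_rpow hn hpq hc hl
    (VarExp.continuous_gradient hu.1).enorm.measurable
    fun θ hθ => VarExp.one_le_lintegral_gradient h₁ h₂ hu hθ
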